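/- Let $(V, V_+, v)$ and $(W, W_+, w)$ be complete order unit spaces, that is, archimedean partially ordered real vector spaces with positive cones $V_+$, $W_+$ and order units $v$, $w$, that are Banach spaces for the order unit norms $\|x\|_v = \inf\{\lambda > 0 : -\lambda v \le x \le \lambda v\}$ and $\|\cdot\|_w$ (defined in the same way). Let $C = \{x \in V : x \ge \varepsilon v \text{ for some } \varepsilon > 0\}$ and $D = \{z \in W : z \ge \varepsilon w \text{ for some } \varepsilon > 0\}$ be their open cones. Let $\Phi\colon C \to D$ be a gauge-reversing bijection, i.e. a bijection such that $x \le y \iff \Phi(y) \le \Phi(x)$ and $\Phi(\lambda x) = \lambda^{-1}\Phi(x)$ for all $x, y \in C$ and $\lambda > 0$. Then for all $x, u \in C$ the (one-sided) Gateaux derivative $D\Phi(x)(u) = \lim_{\mu \downarrow 0} \mu^{-1}(\Phi(x+\mu u) - \Phi(x))$ exists in $(W, \|\cdot\|_w)$, and for all $x, y \in C$ one has Hua's identity $$\Phi(x) - \Phi(x+y) = -D\Phi(x)\bigl(\Phi^{-1}(\Phi(x)+\Phi(y))\bigr).$$ Consequently, for all $x, u \in C$ with $2u \le x$ one has $\Phi(u)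 - \Phi(x) \in D$ and $$D\Phi(x)(u) = \Phi\bigl(x+\Phi^{-1}(\Phi(u)-\Phi(x))\bigr) - \Phi(x).$$ -/

import Mathlib

open Filter Topology

/-- The order unit norm `‖x‖_v = inf {c > 0 : -c v ≤ x ≤ c v}`. -/
noncomputable def orderUnitNorm {V : Type*} [AddCommGroup V] [Module ℝ V] [PartialOrder V]
    (v x : V) : ℝ :=
  sInf {c : ℝ | 0 < c ∧ -(c • v) ≤ x ∧ x ≤ c • v}

/-- `(V, V_+, v)` is an order unit space, where `V_+ = {x | 0 ≤ x}`: the partially ordered vector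
space `V` is archimedean and `v` is an order unit. The norm that `V` carries is required to be the
order unit norm, so that `CompleteSpace V` says that the order unit space is complete. -/
structure IsOrderUnitSpace (V : Type*) [NormedAddCommGroup V] [NormedSpace ℝ V] [PartialOrder V]
    [IsOrderedAddMonoid V] [IsOrderedModule ℝ V] (v : V) : Prop where
  archimedean : ∀ x : V, BddAbove {y : V | ∃ c : ℝ, 0 ≤ c ∧ y = c • x} → x ≤ 0
  unit_nonneg : 0 ≤ v
  exists_le_smul : ∀ x : V, ∃ c : ℝ, 0 < c ∧ x ≤ c • v
  norm_eq : ∀ x : V, ‖x‖ = orderUnitNorm v x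

/-- The open cone `V_+° = {x : ε v ≤ x for some ε > 0}`. -/
def openCone {V : Type*} [AddCommGroup V] [Module ℝ V] [PartialOrder V]
    [IsOrderedAddMonoid V] [IsOrderedModule ℝ V] (v : V) : ConvexCone ℝ V where
  carrier := {x | ∃ ε : ℝ, 0 < ε ∧ ε • v ≤ x}
  smul_mem' := by
    rintro c hc x ⟨ε, hε, hx⟩
    exact ⟨c * ε, mul_pos hc hε, by
      rw [mul_smul]; exact smul_le_smul_of_nonneg_left hx hc.le⟩
  add_mem' := by
    rintro x ⟨ε, hε, hx⟩ y ⟨δ, hδ, hy⟩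
    exact ⟨ε + δ, add_pos hε hδ, by rw [add_smul]; exact add_le_add hx hy⟩

/-- A bijection `Φ : C → D` between open cones is gauge-reversing if it is an
order-anti-isomorphism and homogeneous of degree `-1`. -/
structure IsGaugeReversing {V W : Type*}
    [AddCommGroup V] [Module ℝ V] [PartialOrder V] [IsOrderedAddMonoid V] [IsOrderedModule ℝ V]
    [AddCommGroup W] [Module ℝ W] [PartialOrder W] [IsOrderedAddMonoid W] [IsOrderedModule ℝ W]
    {v : V} {w : W} (Φ : openCone v ≃ openCone w) : Prop where
  le_iff_le : ∀ x y : openCone v, (Φ x : W) ≤ Φ y ↔ (y : V) ≤ x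
  map_smul : ∀ (c : ℝ) (hc : 0 < c) (x : openCone v),
    (Φ ⟨c • (x : V), (openCone v).smul_mem hc x.2⟩ : W) = c⁻¹ • (Φ x : W)

/-- `q` is the (one-sided) Gateaux derivative at `x ∈ F` in the direction `p` of a function
`f : F → Y` defined on a subset `F` of `X`: for small `μ > 0` one has `x + μ p ∈ F`, and
`μ⁻¹ ‖f (x + μ p) - f x - μ q‖ → 0` as `μ ↓ 0`. -/
def HasGateauxDerivAt {X Y : Type*} [NormedAddCommGroup X] [NormedSpace ℝ X]
    [NormedAddCommGroup Y] [NormedSpace ℝ Y] {F : Set X} (f : F → Y) (x : F) (p : X) (q : Y) :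
    Prop :=
  ∀ ε : ℝ, 0 < ε → ∀ᶠ μ : ℝ in 𝓝[>] 0, ∃ h : (x : X) + μ • p ∈ F,
    μ⁻¹ * ‖f ⟨(x : X) + μ • p, h⟩ - f x - μ • q‖ < ε

/-! ### Hahn–Banach for gauges -/

section Sublinear

/-! For fixed `x`, the equation `Φ (x + Θ y) = Φ x - Φ (x + y)` defines an order-reversing
involution `Θ` of the open cone. The crux is that `Θ` is homogeneous of degree -1.

Let `0 < t ≤ 1` and `E p = Θ (t Θ p)`. Then `E` is an order embedding with `p ≤ E p`, and `E (s x) =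
t⁻¹ s x` by direct computation. By `IsPureState.le_of_lt_of_expansive`, `g p < g q` implies `g (E p)
≤ g (E q)` for every pure state `g`. Comparing `p` with multiples of `x` gives `g (E p) = t⁻¹ g p`.
Pure states determine the order (Krein–Milman), so `E p = t⁻¹ p`.

Now `Φ ∘ Θ` is gauge-preserving, hence additive (`IsGaugePreserving.map_add`). As `Θ x = x`, it
sends `x + Θ y` to `Φ x + Φ y`, which is Hua's identity with `-Φ (Θ u)` in place of the derivative.
Homogeneity also gives `Φ (x + μ u) = Φ x - μ Φ (Θ u + μ x)`, so `-Φ (Θ u)` is the derivative. -/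

/-- Hahn-Banach for the sublinear functional `u ↦ sInf (S u)`. -/
theorem exists_linearMap_le_sInf {E : Type*} [AddCommGroup E] [Module ℝ E] (S : E → Set ℝ)
    (hne : ∀ u, (S u).Nonempty) (hbdd : ∀ u, BddBelow (S u))
    (hsmul : ∀ c : ℝ, 0 < c → ∀ u, ∀ s ∈ S u, c * s ∈ S (c • u))
    (hadd : ∀ u u', ∀ s ∈ S u, ∀ s' ∈ S u', s + s' ∈ S (u + u')) (u₀ : E) :
    ∃ l : E →ₗ[ℝ] ℝ, (∀ u, ∀ s ∈ S u, l u ≤ s) ∧ l u₀ = sInf (S u₀) := by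
  set N : E → ℝ := fun u => sInf (S u) with hN
  have Nle : ∀ u, ∀ s ∈ S u, N u ≤ s := fun u s hs => csInf_le (hbdd u) hs
  have Nsmul_le : ∀ c : ℝ, 0 < c → ∀ u, N (c • u) ≤ c * N u := by
    intro c hc u
    have : N (c • u) / c ≤ N u := by
      refine le_csInf (hne u) fun s hs => ?_
      rw [div_le_iff₀' hc]
      exact Nle _ _ (hsmul c hc u s hs)
    rwa [div_le_iff₀' hc] at this
  have Nsmul : ∀ c : ℝ, 0 < c → ∀ u, N (c • u) = c * N u := by
    intro c hc u
    refine le_antisymm (Nsmul_le c hc u) ?_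
    have h := Nsmul_le c⁻¹ (inv_pos.2 hc) (c • u)
    rw [inv_smul_smul₀ hc.ne'] at h
    calc c * N u ≤ c * (c⁻¹ * N (c • u)) := mul_le_mul_of_nonneg_left h hc.le
      _ = N (c • u) := by rw [mul_inv_cancel_left₀ hc.ne']
  have Nadd : ∀ u u', N (u + u') ≤ N u + N u' := by
    intro u u'
    rw [← sub_le_iff_le_add]
    refine le_csInf (hne u) fun s hs => ?_
    rw [sub_le_comm]
    refine le_csInf (hne u') fun s' hs' => ?_
    have := Nle _ _ (hadd u u' s hs s' hs')
    linarith
  have N0 : N 0 = 0 := by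
    have := Nsmul 2 two_pos 0
    rw [smul_zero] at this
    linarith
  have key : ∃ l : E →ₗ[ℝ] ℝ, (∀ u, l u ≤ N u) ∧ l u₀ = N u₀ := by
    rcases eq_or_ne u₀ 0 with rfl | h0
    · obtain ⟨l, -, hl⟩ := exists_extension_of_le_sublinear (⟨⊥, 0⟩ : E →ₗ.[ℝ] ℝ) N Nsmul Nadd
        (by rintro ⟨x, hx⟩
            obtain rfl : x = 0 := by simpa using hx
            simp [N0])
      exact ⟨l, hl, by rw [map_zero, N0]⟩
    · obtain ⟨l, hl₀, hl⟩ := exists_extension_of_le_sublinear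
        (LinearPMap.mkSpanSingleton u₀ (N u₀) h0) N Nsmul Nadd (by
          rintro ⟨x, hx⟩
          obtain ⟨c, rfl⟩ := Submodule.mem_span_singleton.1 hx
          rw [LinearPMap.mkSpanSingleton'_apply]
          change c * N u₀ ≤ N (c • u₀)
          rcases lt_trichotomy c 0 with hc | rfl | hc
          · have h1 := Nadd (c • u₀) ((-c) • u₀)
            rw [Nsmul (-c) (by linarith), ← add_smul, add_neg_cancel, zero_smul, N0] at h1
            linarith
          · simp [N0]
          · exact (Nsmul c hc u₀).ge)
      refine ⟨l, hl, ?_⟩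
      have := hl₀ ⟨u₀, Submodule.mem_span_singleton_self u₀⟩
      rw [this]
      exact LinearPMap.mkSpanSingleton_apply ℝ ℝ h0 (N u₀)
  obtain ⟨l, hl, hl0⟩ := key
  exact ⟨l, fun u s hs => (hl u).trans (Nle u s hs), hl0⟩

end Sublinear

/-! ### Pure states: they determine the order, and their sublevel sets are directed -/

section PureStates

variable {V : Type*} [NormedAddCommGroup V] [NormedSpace ℝ V] [PartialOrder V] {v : V}

/-- A pure state: a normalized positive functional that spans an extreme ray of the dual cone. -/
structure IsPureState (v : V) (g : V →ₗ[ℝ] ℝ) : Prop where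
  nonneg : ∀ x, 0 ≤ x → 0 ≤ g x
  unit : g v = 1
  extreme : ∀ l : V →ₗ[ℝ] ℝ, (∀ x, 0 ≤ x → 0 ≤ l x) → (∀ x, 0 ≤ x → l x ≤ g x) →
    ∃ c : ℝ, l = c • g

/-- The states of an order unit space, as a set of functions. -/
def stateSet (v : V) : Set (V → ℝ) :=
  {f | (∀ x y, f (x + y) = f x + f y) ∧ (∀ (c : ℝ) x, f (c • x) = c * f x) ∧
    (∀ x, 0 ≤ x → 0 ≤ f x) ∧ f v = 1}

theorem LinearMap.coe_mem_stateSet {l : V →ₗ[ℝ] ℝ} (h : ∀ x, 0 ≤ x → 0 ≤ l x) (h1 : l v = 1) :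
    (l : V → ℝ) ∈ stateSet v :=
  ⟨l.map_add, fun c x => by simp, h, h1⟩

variable [IsOrderedAddMonoid V]

theorem IsPureState.mono {g : V →ₗ[ℝ] ℝ} (hg : IsPureState v g) {x y : V} (h : x ≤ y) :
    g x ≤ g y := by
  have := hg.nonneg (y - x) (sub_nonneg.2 h)
  rw [map_sub] at this
  linarith

theorem LinearMap.nonneg_of_forall_nonpos {l : V →ₗ[ℝ] ℝ} (h : ∀ x, x ≤ 0 → l x ≤ 0) (x : V)
    (hx : 0 ≤ x) : 0 ≤ l x := by
  have := h (-x) (neg_nonpos.2 hx)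
  rw [map_neg] at this
  linarith

variable [IsOrderedModule ℝ V]

theorem IsOrderUnitSpace.exists_state_pos (hV : IsOrderUnitSpace V v) {x : V} (hx : ¬ x ≤ 0) :
    ∃ l : V →ₗ[ℝ] ℝ, (∀ y, 0 ≤ y → 0 ≤ l y) ∧ l v = 1 ∧ 0 < l x := by
  obtain ⟨l, hl, hlx⟩ := exists_linearMap_le_sInf (fun u : V => {c : ℝ | 0 < c ∧ u ≤ c • v})
    (fun u => hV.exists_le_smul u) (fun u => ⟨0, fun c hc => hc.1.le⟩)
    (fun c hc u s hs => ⟨mul_pos hc hs.1, by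
      rw [mul_smul]; exact smul_le_smul_of_nonneg_left hs.2 hc.le⟩)
    (fun u u' s hs s' hs' => ⟨add_pos hs.1 hs'.1, by rw [add_smul]; exact add_le_add hs.2 hs'.2⟩) x
  have hpos : 0 < l x := by
    -- If `x ≤ c v` for all `c > 0`, the nonnegative multiples of `x` are bounded by `v`, against
    -- the archimedean axiom. So the gauge is positive at `x`.
    obtain ⟨c, hc, hcx⟩ : ∃ c : ℝ, 0 < c ∧ ¬ x ≤ c • v := by
      by_contra! h
      refine hx (hV.archimedean x ⟨v, ?_⟩)
      rintro _ ⟨c, hc, rfl⟩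
      rcases hc.eq_or_lt with rfl | hc
      · rw [zero_smul]; exact hV.unit_nonneg
      · have := smul_le_smul_of_nonneg_left (h c⁻¹ (inv_pos.2 hc)) hc.le
        rwa [smul_inv_smul₀ hc.ne'] at this
    rw [hlx]
    refine hc.trans_le (le_csInf (hV.exists_le_smul x) fun s hs => ?_)
    by_contra! hsc
    exact hcx (hs.2.trans (smul_le_smul_of_nonneg_right hsc.le hV.unit_nonneg))
  have hnonneg : ∀ y, 0 ≤ y → 0 ≤ l y := by
    refine LinearMap.nonneg_of_forall_nonpos fun y hy => le_of_forall_pos_le_add fun ε hε => ?_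
    rw [zero_add]
    exact hl y ε ⟨hε, hy.trans (smul_nonneg hε.le hV.unit_nonneg)⟩
  obtain ⟨c, hc, hxc⟩ := hV.exists_le_smul x
  have hlv : 0 < l v := by
    have := hnonneg _ (sub_nonneg.2 hxc)
    rw [map_sub, map_smul, smul_eq_mul] at this
    exact pos_of_mul_pos_right (by linarith : 0 < c * l v) hc.le
  refine ⟨(l v)⁻¹ • l, fun y hy => mul_nonneg (inv_pos.2 hlv).le (hnonneg y hy), ?_,
    mul_pos (inv_pos.2 hlv) hpos⟩
  simp [hlv.ne']

/-- Tychonoff: a state takes values in a fixed compact interval at each vector, and its defining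
conditions are closed pointwise. -/
theorem IsOrderUnitSpace.isCompact_stateSet (hV : IsOrderUnitSpace V v) :
    IsCompact (stateSet v) := by
  choose b hb using hV.exists_le_smul
  have hc : IsClosed (stateSet v) := by
    simp only [stateSet, Set.ofPred_and, Set.ofPred_forall]
    refine (isClosed_iInter fun x => isClosed_iInter fun y => ?_).inter
      ((isClosed_iInter fun c => isClosed_iInter fun x => ?_).inter
      ((isClosed_iInter fun x => isClosed_iInter fun _ => ?_).inter ?_))
    · exact isClosed_eq (by fun_prop) (by fun_prop)
    · exact isClosed_eq (by fun_prop) (by fun_prop)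
    · exact isClosed_le (by fun_prop) (by fun_prop)
    · exact isClosed_eq (by fun_prop) (by fun_prop)
  refine (isCompact_univ_pi fun x : V => isCompact_Icc (a := -b (-x)) (b := b x)).of_isClosed_subset
    hc ?_
  rintro f ⟨hadd, hsmul, hpos, h1⟩ x -
  have key : ∀ y, f y ≤ b y := fun y => by
    have h2 := hpos _ (sub_nonneg.2 (hb y).2)
    rw [sub_eq_add_neg, ← neg_one_smul ℝ y, hadd, hsmul, hsmul, h1] at h2
    linarith
  have h3 := key (-x)
  rw [← neg_one_smul ℝ x, hsmul] at h3
  refine ⟨?_, key x⟩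
  rw [← neg_one_smul ℝ x]
  linarith

theorem IsOrderUnitSpace.eq_zero_of_nonneg_of_unit (hV : IsOrderUnitSpace V v)
    {l : V →ₗ[ℝ] ℝ} (h : ∀ x, 0 ≤ x → 0 ≤ l x) (h0 : l v = 0) : l = 0 := by
  have key : ∀ x, l x ≤ 0 := fun x => by
    obtain ⟨c, -, hc⟩ := hV.exists_le_smul x
    have := h _ (sub_nonneg.2 hc)
    rw [map_sub, map_smul, h0, smul_zero] at this
    linarith
  ext x
  have := key (-x)
  rw [map_neg] at this
  exact le_antisymm (key x) (by simpa using this)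

/-- If `0 ≤ l ≤ g`, then `g` is the convex combination, with weights `l v` and `1 - l v`, of the
normalizations of `l` and `g - l`. Extremality identifies these with `g`; the cases of weight zero
are separate. -/
theorem IsOrderUnitSpace.isPureState_of_mem_extremePoints (hV : IsOrderUnitSpace V v)
    {f : V → ℝ} (hf : f ∈ (stateSet v).extremePoints ℝ) :
    ∃ g : V →ₗ[ℝ] ℝ, IsPureState v g ∧ ⇑g = f := by
  obtain ⟨hadd, hsmul, hpos, h1⟩ := hf.1
  let g : V →ₗ[ℝ] ℝ := ⟨⟨f, hadd⟩, hsmul⟩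
  have hgf : ⇑g = f := rfl
  refine ⟨g, ⟨hpos, h1, fun l hl hlg => ?_⟩, rfl⟩
  have hgl : ∀ x, 0 ≤ x → 0 ≤ (g - l) x := fun x hx => by
    simpa using hlg x hx
  have hlv0 := hl v hV.unit_nonneg
  have hlv1 := hgl v hV.unit_nonneg
  have hg1 : g v = 1 := h1
  rw [LinearMap.sub_apply, hg1] at hlv1
  rcases hlv0.eq_or_lt with h | h0
  · exact ⟨0, by rw [zero_smul, hV.eq_zero_of_nonneg_of_unit hl h.symm]⟩
  rcases hlv1.eq_or_lt with h | h2
  · refine ⟨1, ?_⟩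
    have := hV.eq_zero_of_nonneg_of_unit hgl (by rw [LinearMap.sub_apply, hg1, ← h])
    rw [one_smul]
    exact (sub_eq_zero.1 this).symm
  refine ⟨l v, ?_⟩
  have hm1 : ⇑((l v)⁻¹ • l) ∈ stateSet v := LinearMap.coe_mem_stateSet
    (fun x hx => mul_nonneg (inv_pos.2 h0).le (hl x hx)) (by simp [h0.ne'])
  have hm2 : ⇑((1 - l v)⁻¹ • (g - l)) ∈ stateSet v := LinearMap.coe_mem_stateSet
    (fun x hx => mul_nonneg (inv_pos.2 h2).le (hgl x hx)) (by simp [hg1, h2.ne'])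
  have hseg : f ∈ openSegment ℝ ⇑((l v)⁻¹ • l) ⇑((1 - l v)⁻¹ • (g - l)) := by
    refine ⟨l v, 1 - l v, h0, h2, by ring, ?_⟩
    ext x
    simp only [LinearMap.coe_smul, Pi.add_apply, Pi.smul_apply, LinearMap.sub_apply, smul_eq_mul]
    rw [mul_inv_cancel_left₀ h0.ne', mul_inv_cancel_left₀ h2.ne', hgf]
    ring
  have heq := hf.2 hm1 hm2 hseg
  ext x
  have := congrFun heq x
  simp only [LinearMap.coe_smul, Pi.smul_apply, smul_eq_mul] at this
  simp only [LinearMap.smul_apply, smul_eq_mul, hgf]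
  rw [← this, mul_inv_cancel_left₀ h0.ne']

/-- Pure states determine the order. -/
theorem IsOrderUnitSpace.le_of_forall_pureState (hV : IsOrderUnitSpace V v) {y z : V}
    (h : ∀ g : V →ₗ[ℝ] ℝ, IsPureState v g → g y ≤ g z) : y ≤ z := by
  by_contra hyz
  obtain ⟨l, hl, hlv, hlx⟩ := hV.exists_state_pos (x := y - z) (by rwa [sub_nonpos])
  have hconv : Convex ℝ (stateSet v) := by
    rintro f ⟨h1, h2, h3, h4⟩ f' ⟨h1', h2', h3', h4'⟩ a b ha hb hab
    refine ⟨fun x y => ?_, fun c x => ?_, fun x hx => ?_, ?_⟩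
    · simp only [Pi.add_apply, Pi.smul_apply, smul_eq_mul, h1, h1']; ring
    · simp only [Pi.add_apply, Pi.smul_apply, smul_eq_mul, h2, h2']; ring
    · exact add_nonneg (mul_nonneg ha (h3 x hx)) (mul_nonneg hb (h3' x hx))
    · simp [h4, h4', hab]
  have hsub : stateSet v ⊆ {f : V → ℝ | f y ≤ f z} := by
    -- Krein–Milman carries the inequality from pure states to all states.
    rw [← closure_convexHull_extremePoints hV.isCompact_stateSet hconv]
    refine closure_minimal (convexHull_min ?_ ?_) (isClosed_le (by fun_prop) (by fun_prop))
    · intro f hf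
      obtain ⟨g, hg, rfl⟩ := hV.isPureState_of_mem_extremePoints hf
      exact h g hg
    · intro f hf f' hf' a b ha hb _
      simp only [Set.mem_ofPred_eq, Pi.add_apply, Pi.smul_apply, smul_eq_mul] at hf hf' ⊢
      exact add_le_add (mul_le_mul_of_nonneg_left hf ha) (mul_le_mul_of_nonneg_left hf' hb)
  have := hsub (LinearMap.coe_mem_stateSet hl hlv)
  rw [map_sub] at hlx
  exact absurd hlx (by simpa using this)

/-- The sublevel sets of a pure state are directed. -/
theorem IsPureState.exists_upper_bound_lt (hV : IsOrderUnitSpace V v) {g : V →ₗ[ℝ] ℝ}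
    (hg : IsPureState v g) {u₁ u₂ : V} {r : ℝ} (h₁ : g u₁ < r) (h₂ : g u₂ < r) :
    ∃ x, u₁ ≤ x ∧ u₂ ≤ x ∧ g x < r := by
  -- Consider the infimum of `g` over common upper bounds of a pair. A dominated functional
  -- attaining it at `(u₁, u₂)` splits as `l₁ + l₂` with `l₁`, `l₂` positive and summing to `g`.
  -- Purity makes both multiples of `g`, so the infimum is a convex combination of `g u₁` and `g
  -- u₂`.
  obtain ⟨l, hl, hlu⟩ := exists_linearMap_le_sInf
    (fun u : V × V => {s : ℝ | ∃ x, u.1 ≤ x ∧ u.2 ≤ x ∧ s = g x})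
    (fun u => by
      obtain ⟨c, hc, h⟩ := hV.exists_le_smul u.1
      obtain ⟨d, hd, h'⟩ := hV.exists_le_smul u.2
      refine ⟨_, (c + d) • v, ?_, ?_, rfl⟩
      · exact h.trans (smul_le_smul_of_nonneg_right (by linarith) hV.unit_nonneg)
      · exact h'.trans (smul_le_smul_of_nonneg_right (by linarith) hV.unit_nonneg))
    (fun u => ⟨g u.1, by rintro _ ⟨x, hx, -, rfl⟩; exact hg.mono hx⟩)
    (by
      rintro c hc u _ ⟨x, hx, hx', rfl⟩
      exact ⟨c • x, smul_le_smul_of_nonneg_left hx hc.le, smul_le_smul_of_nonneg_left hx' hc.le,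
        by simp⟩)
    (by
      rintro u u' _ ⟨x, hx, hx', rfl⟩ _ ⟨y, hy, hy', rfl⟩
      exact ⟨x + y, add_le_add hx hy, add_le_add hx' hy', by simp⟩) (u₁, u₂)
  set l₁ : V →ₗ[ℝ] ℝ := l ∘ₗ LinearMap.inl ℝ V V with hl₁
  set l₂ : V →ₗ[ℝ] ℝ := l ∘ₗ LinearMap.inr ℝ V V with hl₂
  have hsum : ∀ a b, l (a, b) = l₁ a + l₂ b := fun a b => by
    rw [hl₁, hl₂, LinearMap.comp_apply, LinearMap.comp_apply, ← map_add]
    simp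
  have hdiag : l₁ + l₂ = g := by
    have key : ∀ a, l₁ a + l₂ a ≤ g a := fun a => by
      rw [← hsum]; exact hl (a, a) _ ⟨a, le_rfl, le_rfl, rfl⟩
    ext a
    refine le_antisymm (key a) ?_
    have := key (-a)
    simp only [map_neg] at this
    rw [LinearMap.add_apply]
    linarith
  have hp₁ : ∀ x, 0 ≤ x → 0 ≤ l₁ x := LinearMap.nonneg_of_forall_nonpos fun x hx => by
    have := hl (x, 0) 0 ⟨0, hx, le_rfl, by simp⟩
    rwa [hsum, map_zero, add_zero] at this
  have hp₂ : ∀ x, 0 ≤ x → 0 ≤ l₂ x := LinearMap.nonneg_of_forall_nonpos fun x hx => by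
    have := hl (0, x) 0 ⟨0, le_rfl, hx, by simp⟩
    rwa [hsum, map_zero, zero_add] at this
  obtain ⟨c₁, hc₁⟩ := hg.extreme l₁ hp₁ fun x hx => by
    rw [← hdiag, LinearMap.add_apply]; linarith [hp₂ x hx]
  obtain ⟨c₂, hc₂⟩ := hg.extreme l₂ hp₂ fun x hx => by
    rw [← hdiag, LinearMap.add_apply]; linarith [hp₁ x hx]
  have e₁ : 0 ≤ c₁ := by
    have := hp₁ v hV.unit_nonneg
    rwa [hc₁, LinearMap.smul_apply, hg.unit, smul_eq_mul, mul_one] at this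
  have e₂ : 0 ≤ c₂ := by
    have := hp₂ v hV.unit_nonneg
    rwa [hc₂, LinearMap.smul_apply, hg.unit, smul_eq_mul, mul_one] at this
  have e : c₁ + c₂ = 1 := by
    have := congrArg (fun k : V →ₗ[ℝ] ℝ => k v) hdiag
    simpa [hc₁, hc₂, hg.unit] using this
  have hlt : l (u₁, u₂) < r := by
    rw [hsum, hc₁, hc₂]
    simp only [LinearMap.smul_apply, smul_eq_mul]
    obtain rfl : c₂ = 1 - c₁ := by linarith
    rcases e₁.eq_or_lt with rfl | e₁
    · simpa using h₂
    · nlinarith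
  rw [hlu] at hlt
  obtain ⟨_, ⟨x, hx₁, hx₂, rfl⟩, hx⟩ := exists_lt_of_csInf_lt (by
    obtain ⟨c, hc, h⟩ := hV.exists_le_smul u₁
    obtain ⟨d, hd, h'⟩ := hV.exists_le_smul u₂
    refine ⟨_, (c + d) • v, ?_, ?_, rfl⟩
    · exact h.trans (smul_le_smul_of_nonneg_right (by linarith) hV.unit_nonneg)
    · exact h'.trans (smul_le_smul_of_nonneg_right (by linarith) hV.unit_nonneg)) hlt
  exact ⟨x, hx₁, hx₂, hx⟩

end PureStates

/-! ### The open cone and expansive order embeddings -/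

section OpenCone

variable {V : Type*} [NormedAddCommGroup V] [NormedSpace ℝ V] [PartialOrder V]
  [IsOrderedAddMonoid V] [IsOrderedModule ℝ V] {v : V}

theorem openCone.mem_of_le {x y : V} (hx : x ∈ openCone v) (h : x ≤ y) : y ∈ openCone v := by
  obtain ⟨ε, hε, hx⟩ := hx
  exact ⟨ε, hε, hx.trans h⟩

/-- Multiplication of an element of the open cone by a positive scalar. -/
def openCone.psmul (c : ℝ) (hc : 0 < c) (x : openCone v) : openCone v :=
  ⟨c • (x : V), (openCone v).smul_mem hc x.2⟩

theorem openCone.coe_psmul {c : ℝ} (hc : 0 < c) (x : openCone v) :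
    (openCone.psmul c hc x : V) = c • (x : V) := rfl

theorem openCone.coe_add (x y : openCone v) : ((x + y : openCone v) : V) = x + y := rfl

namespace IsOrderUnitSpace

theorem nonneg_of_mem (hV : IsOrderUnitSpace V v) (x : openCone v) : (0 : V) ≤ x := by
  obtain ⟨ε, hε, hx⟩ := x.2
  exact (smul_nonneg hε.le hV.unit_nonneg).trans hx

theorem exists_le_smul_of_mem (hV : IsOrderUnitSpace V v) (x : openCone v) (y : V) :
    ∃ c : ℝ, 0 < c ∧ y ≤ c • (x : V) := by
  obtain ⟨ε, hε, hx⟩ := x.2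
  obtain ⟨c, hc, hy⟩ := hV.exists_le_smul y
  refine ⟨c / ε, div_pos hc hε, hy.trans ?_⟩
  have := smul_le_smul_of_nonneg_left hx (div_pos hc hε).le
  rwa [smul_smul, div_mul_cancel₀ _ hε.ne'] at this

theorem norm_le (hV : IsOrderUnitSpace V v) {x : V} {c : ℝ} (hc : 0 < c) (h0 : 0 ≤ x)
    (hx : x ≤ c • v) : ‖x‖ ≤ c := by
  rw [hV.norm_eq, orderUnitNorm]
  exact csInf_le ⟨0, fun _ h => h.1.le⟩
    ⟨hc, (neg_nonpos.2 (smul_nonneg hc.le hV.unit_nonneg)).trans h0, hx⟩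

end IsOrderUnitSpace

theorem IsPureState.pos {g : V →ₗ[ℝ] ℝ} (hg : IsPureState v g) (x : openCone v) :
    0 < g x := by
  obtain ⟨ε, hε, hx⟩ := x.2
  have := hg.mono hx
  rw [map_smul, hg.unit, smul_eq_mul, mul_one] at this
  exact hε.trans_le this

theorem IsPureState.exists_upper_bound_mem_lt (hV : IsOrderUnitSpace V v) {g : V →ₗ[ℝ] ℝ}
    (hg : IsPureState v g) {u₁ u₂ : openCone v} {r : ℝ} (h₁ : g u₁ < r) (h₂ : g u₂ < r) :
    ∃ x : openCone v, (u₁ : V) ≤ x ∧ (u₂ : V) ≤ x ∧ g x < r := by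
  obtain ⟨x, hx₁, hx₂, hx⟩ := hg.exists_upper_bound_lt hV h₁ h₂
  exact ⟨⟨x, openCone.mem_of_le u₁.2 hx₁⟩, hx₁, hx₂, hx⟩

/-- For an expansive order embedding `E` of the open cone into itself and a pure state `g`, the
value `g (E p)` is a monotone function of `g p`. -/
theorem IsPureState.le_of_lt_of_expansive (hV : IsOrderUnitSpace V v) {g : V →ₗ[ℝ] ℝ}
    (hg : IsPureState v g) {E : openCone v → openCone v}
    (hE : ∀ p q : openCone v, (E p : V) ≤ E q ↔ (p : V) ≤ q)
    (hE' : ∀ p : openCone v, (p : V) ≤ E p) {p q : openCone v} (hpq : g p < g q) :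
    g (E p) ≤ g (E q) := by
  obtain ⟨r, hpr, hrq⟩ := exists_between hpq
  have hr : 0 < r := (hg.pos p).trans hpr
  have hne : ∀ u : V, {s : ℝ | 0 < s ∧ ∃ x : openCone v, g x < r ∧ u ≤ s • (E x : V)}.Nonempty :=
    fun u => by
      obtain ⟨c, hc, h⟩ := hV.exists_le_smul_of_mem (E p) u
      exact ⟨c, hc, p, hpr, h⟩
  -- The gauge of the set of vectors below some `E x` with `g x < r`. Directedness of the sublevel
  -- set makes it subadditive. It is at most 1 at `E p` and at least 1 at `E q`; purity will make
  -- `l` a multiple of `g`.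
  obtain ⟨l, hl, hlq⟩ := exists_linearMap_le_sInf
    (fun u : V => {s : ℝ | 0 < s ∧ ∃ x : openCone v, g x < r ∧ u ≤ s • (E x : V)})
    hne (fun u => ⟨0, fun s hs => hs.1.le⟩)
    (by
      rintro c hc u s ⟨hs, x, hx, h⟩
      refine ⟨mul_pos hc hs, x, hx, ?_⟩
      rw [mul_smul]
      exact smul_le_smul_of_nonneg_left h hc.le)
    (by
      rintro u u' s ⟨hs, x, hx, h⟩ s' ⟨hs', x', hx', h'⟩
      obtain ⟨y, hxy, hxy', hy⟩ := hg.exists_upper_bound_mem_lt hV hx hx'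
      refine ⟨add_pos hs hs', y, hy, ?_⟩
      rw [add_smul]
      exact add_le_add
        (h.trans (smul_le_smul_of_nonneg_left ((hE _ _).2 hxy) hs.le))
        (h'.trans (smul_le_smul_of_nonneg_left ((hE _ _).2 hxy') hs'.le))) (E q)
  have hlpos : ∀ x, 0 ≤ x → 0 ≤ l x := LinearMap.nonneg_of_forall_nonpos fun x hx =>
    le_of_forall_pos_le_add fun ε hε => by
      rw [zero_add]
      exact hl x ε ⟨hε, p, hpr, hx.trans (smul_nonneg hε.le (hV.nonneg_of_mem _))⟩
  -- Expansiveness enters here: it bounds the gauge by `g / r` on the positive cone. The multiple of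
  -- `v` moves `(r / t) • x` into the open cone and uses half of the gap `r - (r / t) * g x`.
  have hlg : ∀ x, 0 ≤ x → r * l x ≤ g x := fun x hx => by
    refine le_of_forall_gt_imp_ge_of_dense fun t ht => ?_
    have hgx : 0 ≤ g x := hg.nonneg x hx
    have ht0 : 0 < t := hgx.trans_lt ht
    have hδ : 0 < (t - g x) * r / (2 * t) := by
      have := sub_pos.2 ht
      positivity
    have hmem : (r / t) • x + ((t - g x) * r / (2 * t)) • v ∈ openCone v :=
      ⟨_, hδ, le_add_of_nonneg_left (smul_nonneg (by positivity) hx)⟩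
    have h1 := hl x (t / r) ⟨by positivity, ⟨_, hmem⟩, ?_, ?_⟩
    · rwa [le_div_iff₀' hr] at h1
    · change g ((r / t) • x + ((t - g x) * r / (2 * t)) • v) < r
      rw [map_add, map_smul, map_smul, hg.unit, smul_eq_mul, smul_eq_mul, mul_one]
      have : r - (r / t * g x + (t - g x) * r / (2 * t)) = (t - g x) * r / (2 * t) := by
        field_simp
        ring
      linarith
    · have h2 : (r / t) • x ≤ (E ⟨_, hmem⟩ : V) :=
        (le_add_of_nonneg_right (smul_nonneg hδ.le hV.unit_nonneg)).trans (hE' ⟨_, hmem⟩)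
      have h3 := smul_le_smul_of_nonneg_left h2 (div_pos ht0 hr).le
      rwa [smul_smul, div_mul_div_cancel₀ hr.ne', div_self ht0.ne', one_smul] at h3
  obtain ⟨c, hc⟩ := hg.extreme (r • l) (fun x hx => mul_nonneg hr.le (hlpos x hx)) hlg
  have hval : ∀ x, r * l x = c * g x := fun x => by
    simpa using congrArg (fun k : V →ₗ[ℝ] ℝ => k x) hc
  have h1 : l (E p) ≤ 1 := hl _ 1 ⟨one_pos, p, hpr, by rw [one_smul]⟩
  have h2 : 1 ≤ l (E q) := by
    rw [hlq]
    refine le_csInf (hne _) ?_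
    rintro s ⟨hs, x, hx, h⟩
    by_contra! hs1
    have h3 : (E q : V) ≤ E x := h.trans
      ((smul_le_smul_of_nonneg_right hs1.le (hV.nonneg_of_mem _)).trans (one_smul ℝ _).le)
    have := hg.mono ((hE _ _).1 h3)
    linarith
  have h4 := hval (E p)
  have h5 := hval (E q)
  have hEq := hg.pos (E q)
  have hc0 : 0 < c := by
    refine pos_of_mul_pos_left ?_ hEq.le
    rw [← h5]
    positivity
  refine le_of_mul_le_mul_left ?_ hc0
  rw [← h4, ← h5]
  exact mul_le_mul_of_nonneg_left (h1.trans h2) hr.le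

end OpenCone

/-! ### Additivity of gauge-preserving bijections -/

section GaugePreserving

variable {V W : Type*}
  [NormedAddCommGroup V] [NormedSpace ℝ V] [PartialOrder V] [IsOrderedAddMonoid V]
  [IsOrderedModule ℝ V]
  [NormedAddCommGroup W] [NormedSpace ℝ W] [PartialOrder W] [IsOrderedAddMonoid W]
  [IsOrderedModule ℝ W] {v : V} {w : W}

/-- A bijection between open cones is gauge-preserving if it is an order isomorphism that is
homogeneous of degree `1`. -/
structure IsGaugePreserving (A : openCone v ≃ openCone w) : Prop where
  le_iff_le : ∀ x y : openCone v, (A x : W) ≤ A y ↔ (x : V) ≤ y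
  map_psmul : ∀ (c : ℝ) (hc : 0 < c) (x : openCone v),
    (A (openCone.psmul c hc x) : W) = c • (A x : W)

namespace IsGaugePreserving

variable {A : openCone v ≃ openCone w}

theorem symm (hA : IsGaugePreserving A) : IsGaugePreserving A.symm where
  le_iff_le x y := by rw [← hA.le_iff_le, A.apply_symm_apply, A.apply_symm_apply]
  map_psmul c hc x := by
    rw [← openCone.coe_psmul hc, Subtype.coe_inj, Equiv.symm_apply_eq]
    ext
    rw [hA.map_psmul, A.apply_symm_apply]
    rfl

/-- Tested on a pure state: directedness gives one `t` with `x ≤ r₁ t`, `y ≤ r₂ t` and `g (A t) <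
1`, hence `g (A (x + y)) ≤ (r₁ + r₂) g (A t)`. -/
theorem map_add_le (hA : IsGaugePreserving A) (hW : IsOrderUnitSpace W w) (x y : openCone v) :
    (A (x + y) : W) ≤ A x + A y := by
  refine hW.le_of_forall_pureState fun g hg => le_of_forall_pos_lt_add fun ε hε => ?_
  have hr₁ : 0 < g (A x) + ε / 2 := by linarith [hg.pos (A x)]
  have hr₂ : 0 < g (A y) + ε / 2 := by linarith [hg.pos (A y)]
  set r₁ := g (A x) + ε / 2 with hr₁'
  set r₂ := g (A y) + ε / 2 with hr₂'
  have hlt : ∀ (z : openCone v) (r : ℝ) (hr : 0 < r), g (A z) < r →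
      g (A (openCone.psmul r⁻¹ (inv_pos.2 hr) z)) < 1 := fun z r hr hz => by
    rw [hA.map_psmul, map_smul, smul_eq_mul, inv_mul_lt_iff₀ hr, mul_one]
    exact hz
  obtain ⟨z, h₁, h₂, hz⟩ := hg.exists_upper_bound_mem_lt hW
    (hlt x r₁ hr₁ (by linarith)) (hlt y r₂ hr₂ (by linarith))
  obtain ⟨t, rfl⟩ := A.surjective z
  rw [hA.le_iff_le, openCone.coe_psmul, inv_smul_le_iff_of_pos hr₁] at h₁
  rw [hA.le_iff_le, openCone.coe_psmul, inv_smul_le_iff_of_pos hr₂] at h₂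
  have h : ((x + y : openCone v) : V) ≤ openCone.psmul (r₁ + r₂) (add_pos hr₁ hr₂) t := by
    rw [openCone.coe_add, openCone.coe_psmul, add_smul]
    exact add_le_add h₁ h₂
  have h' := hg.mono ((hA.le_iff_le _ _).2 h)
  rw [hA.map_psmul, map_smul, smul_eq_mul] at h'
  rw [LinearMap.map_add]
  nlinarith

/-- Gauge-preserving bijections are additive. -/
theorem map_add (hA : IsGaugePreserving A) (hV : IsOrderUnitSpace V v) (hW : IsOrderUnitSpace W w)
    (x y : openCone v) : A (x + y) = A x + A y := by
  ext
  refine le_antisymm (hA.map_add_le hW x y) ?_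
  -- Subadditivity of the inverse is superadditivity of `A`.
  have h := hA.symm.map_add_le hV (A x) (A y)
  rw [A.symm_apply_apply, A.symm_apply_apply, ← openCone.coe_add, ← hA.le_iff_le,
    A.apply_symm_apply] at h
  exact h

end IsGaugePreserving

/-! ### Point reflections and Hua's identity -/

namespace IsGaugeReversing

variable {Φ : openCone v ≃ openCone w}

theorem map_psmul (hΦ : IsGaugeReversing Φ) (c : ℝ) (hc : 0 < c) (x : openCone v) :
    (Φ (openCone.psmul c hc x) : W) = c⁻¹ • (Φ x : W) := hΦ.map_smul c hc x

theorem symm (hΦ : IsGaugeReversing Φ) : IsGaugeReversing Φ.symm where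
  le_iff_le x y := by rw [← hΦ.le_iff_le, Φ.apply_symm_apply, Φ.apply_symm_apply]
  map_smul c hc x := by
    rw [← openCone.coe_psmul (inv_pos.2 hc), Subtype.coe_inj, Equiv.symm_apply_eq]
    ext
    rw [hΦ.map_psmul, Φ.apply_symm_apply, inv_inv]

theorem trans_isGaugePreserving {U : Type*} [NormedAddCommGroup U] [NormedSpace ℝ U]
    [PartialOrder U] [IsOrderedAddMonoid U] [IsOrderedModule ℝ U] {u : U}
    {Θ : openCone u ≃ openCone v} (hΘ : IsGaugeReversing Θ) (hΦ : IsGaugeReversing Φ) :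
    IsGaugePreserving (Θ.trans Φ) where
  le_iff_le x y := by
    rw [Equiv.trans_apply, Equiv.trans_apply, hΦ.le_iff_le, hΘ.le_iff_le]
  map_psmul c hc x := by
    have : Θ (openCone.psmul c hc x) = openCone.psmul c⁻¹ (inv_pos.2 hc) (Θ x) := by
      ext
      exact hΘ.map_psmul c hc x
    rw [Equiv.trans_apply, Equiv.trans_apply, this, hΦ.map_psmul, inv_inv]

/-- From `x ≤ c (y - x)` follows `(1 + c⁻¹) x ≤ y`, so `Φ y` is at most a multiple of `Φ x` with
factor less than 1. -/
theorem sub_mem (hΦ : IsGaugeReversing Φ) (hV : IsOrderUnitSpace V v) {x y : openCone v}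
    (h : (y : V) - x ∈ openCone v) : (Φ x : W) - Φ y ∈ openCone w := by
  obtain ⟨c, hc, hx⟩ := hV.exists_le_smul_of_mem ⟨_, h⟩ x
  have hc1 : 0 < 1 + c⁻¹ := by positivity
  have h1 : (openCone.psmul (1 + c⁻¹) hc1 x : V) ≤ y := by
    rw [openCone.coe_psmul, add_smul, one_smul, ← le_sub_iff_add_le', inv_smul_le_iff_of_pos hc]
    exact hx
  have h2 := (hΦ.le_iff_le _ _).2 h1
  rw [hΦ.map_psmul] at h2
  have h3 : 0 < 1 - (1 + c⁻¹)⁻¹ := by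
    rw [sub_pos]
    exact inv_lt_one_of_one_lt₀ (by linarith [inv_pos.2 hc])
  refine openCone.mem_of_le ((openCone w).smul_mem h3 (Φ x).2) ?_
  rw [sub_smul, one_smul]
  exact sub_le_sub_left h2 _

/-- The point reflection of the open cone in `x`. -/
theorem exists_reflection (hΦ : IsGaugeReversing Φ) (hV : IsOrderUnitSpace V v)
    (hW : IsOrderUnitSpace W w) (x y : openCone v) :
    ∃ z : openCone v, (Φ (x + z) : W) = Φ x - Φ (x + y) := by
  have h1 : (Φ x : W) - Φ (x + y) ∈ openCone w := hΦ.sub_mem hV (by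
    rw [openCone.coe_add, add_sub_cancel_left]
    exact y.2)
  have h2 := hΦ.symm.sub_mem hW (x := ⟨_, h1⟩) (y := Φ x) (by
    rw [sub_sub_cancel]
    exact (Φ (x + y)).2)
  rw [Φ.symm_apply_apply] at h2
  refine ⟨⟨_, h2⟩, ?_⟩
  have : x + ⟨_, h2⟩ = Φ.symm ⟨_, h1⟩ := by
    ext
    rw [openCone.coe_add, add_sub_cancel]
  rw [this, Φ.apply_symm_apply]

theorem reflection_involutive {Θ : openCone v → openCone v} {x : openCone v}
    (hΘ : ∀ y, (Φ (x + Θ y) : W) = Φ x - Φ (x + y)) : Function.Involutive Θ := fun y => by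
  have h : Φ (x + Θ (Θ y)) = Φ (x + y) := by
    ext
    rw [hΘ, hΘ, sub_sub_cancel]
  have h' := congrArg (fun z : openCone v => (z : V)) (Φ.injective h)
  ext
  exact add_left_cancel h'

theorem reflection_le_iff (hΦ : IsGaugeReversing Φ) {Θ : openCone v → openCone v} {x : openCone v}
    (hΘ : ∀ y, (Φ (x + Θ y) : W) = Φ x - Φ (x + y)) (y z : openCone v) :
    (Θ y : V) ≤ Θ z ↔ (z : V) ≤ y := by
  rw [← add_le_add_iff_left (x : V), ← openCone.coe_add, ← openCone.coe_add, ← hΦ.le_iff_le,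
    hΘ, hΘ, sub_le_sub_iff_left, hΦ.le_iff_le, openCone.coe_add, openCone.coe_add,
    add_le_add_iff_left]

/-- On the ray of `x` the claim reduces to `(1 + c)⁻¹ + (1 + c⁻¹)⁻¹ = 1`. -/
theorem reflection_psmul_self (hΦ : IsGaugeReversing Φ) {Θ : openCone v → openCone v}
    {x : openCone v} (hΘ : ∀ y, (Φ (x + Θ y) : W) = Φ x - Φ (x + y)) {c : ℝ} (hc : 0 < c) :
    Θ (openCone.psmul c hc x) = openCone.psmul c⁻¹ (inv_pos.2 hc) x := by
  have hadd : ∀ (d : ℝ) (hd : 0 < d),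
      (Φ (x + openCone.psmul d hd x) : W) = (1 + d)⁻¹ • (Φ x : W) := fun d hd => by
    rw [← hΦ.map_psmul (1 + d) (by linarith)]
    congr 2
    ext
    rw [openCone.coe_add, openCone.coe_psmul, openCone.coe_psmul, add_smul, one_smul]
  have h : Φ (x + Θ (openCone.psmul c hc x)) = Φ (x + openCone.psmul c⁻¹ (inv_pos.2 hc) x) := by
    ext
    rw [hΘ, hadd, hadd, sub_eq_iff_eq_add, ← add_smul]
    have : (1 + c⁻¹)⁻¹ + (1 + c)⁻¹ = 1 := by
      field_simp
      ring
    rw [this, one_smul]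
  have h' := congrArg (fun z : openCone v => (z : V)) (Φ.injective h)
  ext
  exact add_left_cancel h'

theorem reflection_psmul_reflection (hΦ : IsGaugeReversing Φ) (hV : IsOrderUnitSpace V v)
    {Θ : openCone v → openCone v} {x : openCone v}
    (hΘ : ∀ y, (Φ (x + Θ y) : W) = Φ x - Φ (x + y)) {t : ℝ} (ht : 0 < t) (ht1 : t ≤ 1)
    (p : openCone v) :
    (Θ (openCone.psmul t ht (Θ p)) : V) = t⁻¹ • (p : V) := by
  set E : openCone v → openCone v := fun p => Θ (openCone.psmul t ht (Θ p)) with hEdef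
  have hE : ∀ p q : openCone v, (E p : V) ≤ E q ↔ (p : V) ≤ q := fun p q => by
    rw [hEdef, hΦ.reflection_le_iff hΘ, openCone.coe_psmul, openCone.coe_psmul,
      smul_le_smul_iff_of_pos_left ht, hΦ.reflection_le_iff hΘ]
  have hE' : ∀ p : openCone v, (p : V) ≤ E p := fun p => by
    conv_lhs => rw [← reflection_involutive hΘ p]
    rw [hEdef, hΦ.reflection_le_iff hΘ, openCone.coe_psmul]
    exact smul_le_of_le_one_left (hV.nonneg_of_mem _) ht1
  have hEx : ∀ (s : ℝ) (hs : 0 < s), (E (openCone.psmul s hs x) : V) = (t⁻¹ * s) • (x : V) := by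
    intro s hs
    have h1 : openCone.psmul t ht (Θ (openCone.psmul s hs x)) =
        openCone.psmul (t * s⁻¹) (mul_pos ht (inv_pos.2 hs)) x := by
      ext
      rw [hΦ.reflection_psmul_self hΘ, openCone.coe_psmul, openCone.coe_psmul, openCone.coe_psmul,
        mul_smul]
    rw [hEdef]
    dsimp only
    rw [h1, hΦ.reflection_psmul_self hΘ, openCone.coe_psmul, mul_inv, inv_inv]
  have key : ∀ g : V →ₗ[ℝ] ℝ, IsPureState v g → g (E p) = g (t⁻¹ • (p : V)) := by
    intro g hg
    have hx := hg.pos x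
    have hp := hg.pos p
    rw [LinearMap.map_smul, smul_eq_mul]
    -- Compare `p` with the multiple of `x` whose `g`-value is `t * b`; `E` maps it to a vector with
    -- `g`-value `b`.
    refine le_antisymm (le_of_forall_gt_imp_ge_of_dense fun b hb => ?_)
      (le_of_forall_lt_imp_le_of_dense fun b hb => ?_)
    · have hb0 : 0 < b := lt_trans (by positivity) hb
      have hs : 0 < t * b / g x := by positivity
      have h1 := hg.le_of_lt_of_expansive hV hE hE' (p := p) (q := openCone.psmul _ hs x) (by
        rw [openCone.coe_psmul, LinearMap.map_smul, smul_eq_mul, div_mul_cancel₀ _ hx.ne']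
        rwa [inv_mul_lt_iff₀ ht] at hb)
      rw [hEx, LinearMap.map_smul, smul_eq_mul, mul_assoc, div_mul_cancel₀ _ hx.ne',
        inv_mul_cancel_left₀ ht.ne'] at h1
      exact h1
    · rcases le_or_gt b 0 with hb0 | hb0
      · exact hb0.trans (hg.pos (E p)).le
      have hs : 0 < t * b / g x := by positivity
      have h1 := hg.le_of_lt_of_expansive hV hE hE' (p := openCone.psmul _ hs x) (q := p) (by
        rw [openCone.coe_psmul, LinearMap.map_smul, smul_eq_mul, div_mul_cancel₀ _ hx.ne']
        rwa [lt_inv_mul_iff₀ ht] at hb)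
      rw [hEx, LinearMap.map_smul, smul_eq_mul, mul_assoc, div_mul_cancel₀ _ hx.ne',
        inv_mul_cancel_left₀ ht.ne'] at h1
      exact h1
  exact le_antisymm (hV.le_of_forall_pureState fun g hg => (key g hg).le)
    (hV.le_of_forall_pureState fun g hg => (key g hg).ge)

/-- The point reflection in `x` is gauge-reversing. -/
theorem reflection_isGaugeReversing (hΦ : IsGaugeReversing Φ) (hV : IsOrderUnitSpace V v)
    {Θ : openCone v → openCone v} {x : openCone v}
    (hΘ : ∀ y, (Φ (x + Θ y) : W) = Φ x - Φ (x + y)) :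
    IsGaugeReversing (reflection_involutive hΘ).toPerm := by
  have key : ∀ (c : ℝ) (hc : 0 < c), c ≤ 1 → ∀ y : openCone v,
      (Θ (openCone.psmul c hc y) : V) = c⁻¹ • (Θ y : V) := fun c hc hc1 y => by
    rw [← hΦ.reflection_psmul_reflection hV hΘ hc hc1, reflection_involutive hΘ y]
  refine ⟨hΦ.reflection_le_iff hΘ, fun c hc y => ?_⟩
  change (Θ (openCone.psmul c hc y) : V) = c⁻¹ • (Θ y : V)
  rcases le_or_gt c 1 with hc1 | hc1
  · exact key c hc hc1 y
  · have h := key c⁻¹ (inv_pos.2 hc) (inv_le_one_of_one_le₀ hc1.le) (openCone.psmul c hc y)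
    have h1 : openCone.psmul c⁻¹ (inv_pos.2 hc) (openCone.psmul c hc y) = y := by
      ext
      rw [openCone.coe_psmul, openCone.coe_psmul, inv_smul_smul₀ hc.ne']
    rw [h1, inv_inv] at h
    rw [h, inv_smul_smul₀ hc.ne']

/-- Hua's identity for the reflection. -/
theorem reflection_symm_add (hΦ : IsGaugeReversing Φ) (hV : IsOrderUnitSpace V v)
    (hW : IsOrderUnitSpace W w) {Θ : openCone v → openCone v} {x : openCone v}
    (hΘ : ∀ y, (Φ (x + Θ y) : W) = Φ x - Φ (x + y)) (y : openCone v) :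
    Θ (Φ.symm (Φ x + Φ y)) = x + Θ y := by
  have hinv := reflection_involutive hΘ
  have hA := (hΦ.reflection_isGaugeReversing hV hΘ).trans_isGaugePreserving hΦ
  have hx : Θ x = x := by
    have h := hΦ.reflection_psmul_self hΘ one_pos
    have h1 : ∀ (c : ℝ) (hc : 0 < c), c = 1 → openCone.psmul c hc x = x := by
      rintro c hc rfl
      ext
      rw [openCone.coe_psmul, one_smul]
    rwa [h1 _ _ rfl, h1 _ _ inv_one] at h
  have h : Φ (Θ (x + Θ y)) = Φ (Θ x) + Φ (Θ (Θ y)) := hA.map_add hV hW x (Θ y)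
  rw [hx, hinv y] at h
  rw [← h, Φ.symm_apply_apply, hinv]

/-- A gauge-reversing bijection is Gateaux differentiable, with derivative given by the
reflection. -/
theorem hasGateauxDerivAt (hΦ : IsGaugeReversing Φ) (hV : IsOrderUnitSpace V v)
    (hW : IsOrderUnitSpace W w) {Θ : openCone v → openCone v} {x : openCone v}
    (hΘ : ∀ y, (Φ (x + Θ y) : W) = Φ x - Φ (x + y)) (u : openCone v) :
    HasGateauxDerivAt (F := (openCone v : Set V)) (fun z => (Φ z : W)) x (u : V)
      (-(Φ (Θ u) : W)) := by
  intro ε hε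
  obtain ⟨K, hK, hxK⟩ := hV.exists_le_smul_of_mem (Θ u) x
  obtain ⟨M, hM, hΦM⟩ := hW.exists_le_smul (Φ (Θ u) : W)
  have hlim : Tendsto (fun μ : ℝ => μ * K * M) (𝓝[>] 0) (𝓝 0) := by
    have : Tendsto (fun μ : ℝ => μ * K * M) (𝓝 0) (𝓝 (0 * K * M)) :=
      (by fun_prop : Continuous fun μ : ℝ => μ * K * M).tendsto 0
    rw [zero_mul, zero_mul] at this
    exact this.mono_left nhdsWithin_le_nhds
  filter_upwards [self_mem_nhdsWithin, hlim.eventually_lt_const hε] with μ hμ hμε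
  have hμ : 0 < μ := hμ
  refine ⟨(x + openCone.psmul μ hμ u).2, ?_⟩
  set z := Θ u + openCone.psmul μ hμ x with hz
  -- Homogeneity of `Θ` gives `x + Θ (μ u) = μ⁻¹ z`; apply the definition of `Θ` at `μ u`.
  have hstep : (Φ (x + openCone.psmul μ hμ u) : W) = Φ x - μ • (Φ z : W) := by
    have h1 := hΘ (openCone.psmul μ hμ u)
    have h2 : x + Θ (openCone.psmul μ hμ u) = openCone.psmul μ⁻¹ (inv_pos.2 hμ) z := by
      ext
      have h3 := (hΦ.reflection_isGaugeReversing hV hΘ).map_psmul μ hμ u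
      rw [Function.Involutive.coe_toPerm] at h3
      rw [hz, openCone.coe_add, h3, openCone.coe_psmul, openCone.coe_add, openCone.coe_psmul,
        smul_add, inv_smul_smul₀ hμ.ne', add_comm]
    rw [h2, hΦ.map_psmul, inv_inv] at h1
    rw [h1, sub_sub_cancel]
  have hzle : (Φ z : W) ≤ Φ (Θ u) := (hΦ.le_iff_le _ _).2 (by
    rw [hz, openCone.coe_add]
    exact le_add_of_nonneg_right (hV.nonneg_of_mem _))
  have hc : 0 < 1 + μ * K := by positivity
  -- Since `x ≤ K Θ u`, `z ≤ (1 + μ K) Θ u`.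
  have hzge : (1 + μ * K)⁻¹ • (Φ (Θ u) : W) ≤ Φ z := by
    rw [← hΦ.map_psmul _ hc, hΦ.le_iff_le, hz, openCone.coe_add, openCone.coe_psmul,
      openCone.coe_psmul, add_smul, one_smul, mul_smul]
    gcongr
  have hnorm : ‖(Φ (Θ u) : W) - Φ z‖ ≤ μ * K * M := by
    refine hW.norm_le (by positivity) (sub_nonneg.2 hzle) ?_
    have h1 : (Φ (Θ u) : W) - Φ z ≤ (1 - (1 + μ * K)⁻¹) • (Φ (Θ u) : W) := by
      rw [sub_smul, one_smul]
      exact sub_le_sub_left hzge _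
    have h2 : 1 - (1 + μ * K)⁻¹ ≤ μ * K := by
      have h3 : 1 - (1 + μ * K)⁻¹ = μ * K * (1 + μ * K)⁻¹ := by
        field_simp
        ring
      rw [h3]
      exact mul_le_of_le_one_right (by positivity)
        (inv_le_one_of_one_le₀ (le_add_of_nonneg_right (by positivity)))
    refine h1.trans ((smul_le_smul_of_nonneg_right h2 (hW.nonneg_of_mem _)).trans ?_)
    rw [mul_smul (μ * K)]
    exact smul_le_smul_of_nonneg_left hΦM (by positivity)
  have heq : (Φ (x + openCone.psmul μ hμ u) : W) - Φ x - μ • -(Φ (Θ u) : W) =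
      μ • ((Φ (Θ u) : W) - Φ z) := by
    rw [hstep, smul_neg, smul_sub]
    abel
  change μ⁻¹ * ‖(Φ (x + openCone.psmul μ hμ u) : W) - Φ x - μ • -(Φ (Θ u) : W)‖ < ε
  rw [heq, norm_smul, Real.norm_of_nonneg hμ.le, inv_mul_cancel_left₀ hμ.ne']
  exact hnorm.trans_lt hμε

end IsGaugeReversing

end GaugePreserving

/-- Hua's identity for a gauge-reversing bijection `Φ : C → D`; here `DΦ x u` is the Gateaux
derivative of `Φ` at `x ∈ C` in the direction `u ∈ C`. -/
theorem mainTheorem6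
    {V W : Type*}
    [NormedAddCommGroup V] [NormedSpace ℝ V] [CompleteSpace V] [PartialOrder V]
    [IsOrderedAddMonoid V] [IsOrderedModule ℝ V]
    [NormedAddCommGroup W] [NormedSpace ℝ W] [CompleteSpace W] [PartialOrder W]
    [IsOrderedAddMonoid W] [IsOrderedModule ℝ W]
    (v : V) (w : W) (hV : IsOrderUnitSpace V v) (hW : IsOrderUnitSpace W w)
    (Φ : openCone v ≃ openCone w) (hΦ : IsGaugeReversing Φ) :
    ∃ DΦ : openCone v → openCone v → W,
      (∀ x u : openCone v,
        HasGateauxDerivAt (F := (openCone v : Set V)) (fun z => (Φ z : W)) x (u : V) (DΦ x u)) ∧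
      (∀ x y : openCone v,
        (Φ x : W) - (Φ (x + y) : W) = -DΦ x (Φ.symm (Φ x + Φ y))) ∧
      (∀ x u : openCone v, (2 : ℝ) • (u : V) ≤ x →
        ∃ h : (Φ u : W) - (Φ x : W) ∈ openCone w,
          DΦ x u = (Φ (x + Φ.symm ⟨(Φ u : W) - (Φ x : W), h⟩) : W) - (Φ x : W)) := by
  choose Θ hΘ using hΦ.exists_reflection hV hW
  have hua : ∀ x y : openCone v,
      (Φ x : W) - (Φ (x + y) : W) = Φ (Θ x (Φ.symm (Φ x + Φ y))) := fun x y => by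
    rw [hΦ.reflection_symm_add hV hW (hΘ x), hΘ]
  refine ⟨fun x u => -(Φ (Θ x u) : W), fun x u => hΦ.hasGateauxDerivAt hV hW (hΘ x) u,
    fun x y => by rw [hua, neg_neg], fun x u hxu => ?_⟩
  -- `2 u ≤ x` puts `x - u` above `u`, hence in the open cone.
  have h : (Φ u : W) - Φ x ∈ openCone w := hΦ.sub_mem hV (openCone.mem_of_le u.2 (by
    rw [le_sub_iff_add_le, ← two_smul ℝ]
    exact hxu))
  refine ⟨h, ?_⟩
  -- This choice of `y` in Hua's identity makes the direction equal to `u`.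
  have h1 : Φ.symm (Φ x + Φ (Φ.symm ⟨_, h⟩)) = u := by
    rw [Φ.apply_symm_apply, Equiv.symm_apply_eq]
    ext
    rw [openCone.coe_add, add_sub_cancel]
  have h2 := hua x (Φ.symm ⟨_, h⟩)
  rw [h1] at h2
  change -(Φ (Θ x u) : W) = _
  rw [← h2, neg_sub]
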